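/- Let $A$ be a C*-algebra (not necessarily unital) and let $\varphi\colon A\to A$ be a *-endomorphism, not necessarily injective. Let $\mathcal B\subseteq A$ be a dense *-subalgebra with $\varphi(\mathcal B)\subseteq\mathcal B$ that is C*-local: $\psi(b^*b)\in\mathcal B$ for every $b\in\mathcal B$ and every $\psi\in \mathrm C_c(0,\infty]_+$, where $\mathrm C_c(0,\infty]_+$ is the set of continuous functions $\psi\colon[0,\infty)\to[0,\infty)$ that vanish on $[0,\eta]$ for some $\eta>0$ and have a finite limit at $\infty$. Let $A_\infty:=\ell_\infty(A)/c_0(A)$, the quotient of the C*-algebra of bounded sequences in $A$ by the ideal of sequences converging to $0$. For $n\ge 1$ let $\varphi_n\colon A\to A_\infty$ be the *-homomorphism $$\varphi_n(a)=(\underbrace{0,\dots,0}_{n-1},a,\varphi(a),\varphi^2(a),\dots)+c_0(A),$$ and let $A_e:=\overline{\bigcup_{n}\varphi_n(A)}\subseteq A_\infty$, the inductive limit of $A\xrightarrow{\varphi}A\xrightarrow{\varphi}A\xrightarrow{\varphi}\cdots$. The backward shift $(a_1,a_2,\dots)+c_0(A)\mapsto(a_2,a_3,\dots)+c_0(A)$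 restricts to an automorphism $\sigma$ of $A_e$; let $\mathbb Z$ act on $A_e$ by $k\mapsto\sigma^k$. Then the following are equivalent. (i) For all $b_1,b_2,c\in\mathcal B$ and $\varepsilon>0$ there exist integers $k,n_1,n_2\ge 0$ and elements $e_1,e_2\in A$ such that $$\|e_j^*\varphi^k(b_j^*b_j)e_j-\varphi^{n_j}(b_j^*b_j)\|<\varepsilon\quad(j=1,2)\qquad\text{and}\qquad \|e_1^*\varphi^k(c)e_2\|<\varepsilon .$$ (ii) The action of $\mathbb Z$ on $A_e$ is $\mathbb Z$-separating: for all positive $a_1,a_2\in A_e$, all $c\in A_e$ and all $\varepsilon>0$ there exist $d_1,d_2\in A_e$ and $k_1,k_2\in\mathbb Z$ such that $$\|d_j^*a_jd_j-\sigma^{k_j}(a_j)\|<\varepsilon\quad(j=1,2)\qquad\text{and}\qquad \|d_1^*cd_2\|<\varepsilon .$$ -/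

import Mathlib

open Filter Topology
open scoped ENNReal

namespace EndomorphismLimit

/-! ### `ℓ∞(A)`, `c₀(A)` and the C*-algebra `A∞ = ℓ∞(A) / c₀(A)` -/

section Quotient

universe u

variable (A : Type u) [NonUnitalCStarAlgebra A]

/-- The C*-algebra `ℓ∞(A)` of bounded sequences in `A`, with the supremum norm.
Sequences are indexed by `0, 1, 2, …`. -/
abbrev LInfty : Type u := lp (fun _ : ℕ => A) ∞

/-- The closed ideal `c₀(A)` of sequences in `A` that converge to zero. -/
def cZero : Submodule ℂ (LInfty A) where
  carrier := {f | Tendsto (fun n => f n) atTop (𝓝 0)}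
  add_mem' {f g} hf hg := by
    have h := Tendsto.add hf hg
    simpa using h
  zero_mem' := by
    simp
  smul_mem' c f hf := by
    have h := Tendsto.const_smul hf c
    simpa using h

variable {A}

theorem mem_cZero {f : LInfty A} :
    f ∈ cZero A ↔ Tendsto (fun n => f n) atTop (𝓝 0) := Iff.rfl

theorem norm_apply_le (f : LInfty A) (n : ℕ) : ‖f n‖ ≤ ‖f‖ :=
  lp.norm_apply_le_norm ENNReal.top_ne_zero f n

theorem mul_mem_cZero_left (f : LInfty A) {g : LInfty A} (hg : g ∈ cZero A) :
    f * g ∈ cZero A := by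
  rw [mem_cZero, tendsto_zero_iff_norm_tendsto_zero] at *
  refine squeeze_zero (fun n => norm_nonneg _) (fun n => ?_)
    (by simpa using hg.const_mul ‖f‖)
  rw [lp.infty_coeFn_mul]
  exact (norm_mul_le _ _).trans
    (mul_le_mul_of_nonneg_right (norm_apply_le f n) (norm_nonneg _))

theorem mul_mem_cZero_right {f : LInfty A} (hf : f ∈ cZero A) (g : LInfty A) :
    f * g ∈ cZero A := by
  rw [mem_cZero, tendsto_zero_iff_norm_tendsto_zero] at *
  refine squeeze_zero (fun n => norm_nonneg _) (fun n => ?_)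
    (by simpa using hf.mul_const ‖g‖)
  rw [lp.infty_coeFn_mul]
  exact (norm_mul_le _ _).trans
    (mul_le_mul_of_nonneg_left (norm_apply_le g n) (norm_nonneg _))

theorem star_mem_cZero {f : LInfty A} (hf : f ∈ cZero A) : star f ∈ cZero A := by
  rw [mem_cZero, tendsto_zero_iff_norm_tendsto_zero] at *
  simpa using hf

/-- The sequence that agrees with `f` from index `N` on and vanishes before. -/
noncomputable def tail (f : LInfty A) (N : ℕ) : LInfty A :=
  ⟨fun n => if n < N then 0 else f n, memℓp_infty ⟨‖f‖, by
    rintro _ ⟨n, rfl⟩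
    dsimp only
    split_ifs
    · simp
    · exact norm_apply_le f n⟩⟩

theorem tail_apply (f : LInfty A) (N n : ℕ) : tail f N n = if n < N then 0 else f n := rfl

theorem sub_tail_mem (f : LInfty A) (N : ℕ) : f - tail f N ∈ cZero A := by
  rw [mem_cZero]
  refine tendsto_const_nhds.congr' ?_
  filter_upwards [eventually_ge_atTop N] with n hn
  simp [tail_apply, not_lt.mpr hn]

instance isClosed_cZero : IsClosed (cZero A : Set (LInfty A)) := by
  refine isClosed_of_closure_subset fun f hf => ?_
  rw [SetLike.mem_coe, mem_cZero, Metric.tendsto_atTop]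
  intro ε hε
  obtain ⟨g, hg, hfg⟩ := Metric.mem_closure_iff.mp hf (ε / 2) (half_pos hε)
  obtain ⟨N, hN⟩ := Metric.tendsto_atTop.mp (mem_cZero.mp hg) (ε / 2) (half_pos hε)
  refine ⟨N, fun n hn => ?_⟩
  have h1 := norm_apply_le (f - g) n
  have h2 := hN n hn
  rw [dist_eq_norm] at hfg
  rw [dist_zero_right] at h2 ⊢
  have h3 : f n = (f - g) n + g n := by simp
  calc ‖f n‖ ≤ ‖(f - g) n‖ + ‖g n‖ := by rw [h3]; exact norm_add_le _ _
    _ < ε := by linarith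

variable (A)

/-- The quotient `A∞ = ℓ∞(A) / c₀(A)`, with the quotient norm. -/
def AInfty : Type u := LInfty A ⧸ cZero A

noncomputable instance : NormedAddCommGroup (AInfty A) :=
  inferInstanceAs (NormedAddCommGroup (LInfty A ⧸ cZero A))

noncomputable instance : NormedSpace ℂ (AInfty A) :=
  inferInstanceAs (NormedSpace ℂ (LInfty A ⧸ cZero A))

instance : CompleteSpace (AInfty A) :=
  inferInstanceAs (CompleteSpace (LInfty A ⧸ cZero A))

variable {A}

/-- The class of a bounded sequence in `A∞`. -/
noncomputable def mk (f : LInfty A) : AInfty A := Submodule.Quotient.mk f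

theorem mk_surjective : Function.Surjective (mk : LInfty A → AInfty A) :=
  Submodule.Quotient.mk_surjective _

theorem mk_eq_mk {f g : LInfty A} : mk f = mk g ↔ f - g ∈ cZero A :=
  Submodule.Quotient.eq _

theorem norm_mk_le (f : LInfty A) : ‖mk f‖ ≤ ‖f‖ :=
  Submodule.Quotient.norm_mk_le (S := cZero A) f

theorem exists_norm_lt (x : AInfty A) {ε : ℝ} (hε : 0 < ε) :
    ∃ f : LInfty A, mk f = x ∧ ‖f‖ < ‖x‖ + ε :=
  Submodule.Quotient.norm_mk_lt (S := cZero A) x hε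

theorem mk_eq_of_eventuallyEq {f g : LInfty A} (h : ∀ᶠ n in atTop, f n = g n) :
    mk f = mk g := by
  rw [mk_eq_mk, mem_cZero]
  refine tendsto_const_nhds.congr' ?_
  filter_upwards [h] with n hn
  simp [hn]

/-- The quotient norm on `A∞` is given by the limit superior of the norms. -/
theorem norm_mk_le_iff {f : LInfty A} {r : ℝ} (hr : 0 ≤ r) :
    ‖mk f‖ ≤ r ↔ ∀ ε > 0, ∀ᶠ n in atTop, ‖f n‖ ≤ r + ε := by
  constructor
  · intro h ε hε
    obtain ⟨g, hg, hgn⟩ := exists_norm_lt (mk f) (half_pos hε)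
    have h0 : f - g ∈ cZero A := (mk_eq_mk (f := f) (g := g)).mp hg.symm
    rw [mem_cZero, Metric.tendsto_atTop] at h0
    obtain ⟨N, hN⟩ := h0 (ε / 2) (half_pos hε)
    filter_upwards [eventually_ge_atTop N] with n hn
    have h1 := hN n hn
    rw [dist_zero_right] at h1
    have h2 := norm_apply_le g n
    have h3 : f n = (f - g) n + g n := by simp
    calc ‖f n‖ ≤ ‖(f - g) n‖ + ‖g n‖ := by
          conv_lhs => rw [h3]
          exact norm_add_le _ _
      _ ≤ r + ε := by linarith
  · intro h
    refine le_of_forall_pos_le_add fun ε hε => ?_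
    obtain ⟨N, hN⟩ := eventually_atTop.mp (h ε hε)
    have h1 : mk f = mk (tail f N) := (mk_eq_mk (f := f) (g := tail f N)).mpr (sub_tail_mem f N)
    rw [h1]
    refine (norm_mk_le _).trans ?_
    refine lp.norm_le_of_forall_le (by positivity) fun n => ?_
    rw [tail_apply]
    split_ifs with hn
    · simpa using by positivity
    · exact hN n (not_lt.mp hn)

noncomputable instance : Mul (AInfty A) where
  mul := Quotient.map₂ (sa := (cZero A).quotientRel) (sb := (cZero A).quotientRel)
    (sc := (cZero A).quotientRel) (· * ·) (by
    intro f f' hf g g' hg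
    have hf' : f - f' ∈ cZero A := (Submodule.quotientRel_def _).mp hf
    have hg' : g - g' ∈ cZero A := (Submodule.quotientRel_def _).mp hg
    refine (Submodule.quotientRel_def _).mpr ?_
    have h : f * g - f' * g' = (f - f') * g + f' * (g - g') := by
      rw [sub_mul, mul_sub]; abel
    change f * g - f' * g' ∈ cZero A
    rw [h]
    exact add_mem (mul_mem_cZero_right hf' _) (mul_mem_cZero_left _ hg'))

noncomputable instance : Star (AInfty A) where
  star := Quotient.map (sa := (cZero A).quotientRel) (sb := (cZero A).quotientRel)
    star (by
    intro f f' hf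
    have hf' : f - f' ∈ cZero A := (Submodule.quotientRel_def _).mp hf
    refine (Submodule.quotientRel_def _).mpr ?_
    rw [← star_sub]
    exact star_mem_cZero hf')

theorem mk_mul (f g : LInfty A) : mk (f * g) = mk f * mk g := rfl
theorem mk_star (f : LInfty A) : mk (star f) = star (mk f) := rfl
theorem mk_add (f g : LInfty A) : mk (f + g) = mk f + mk g := rfl
theorem mk_smul (c : ℂ) (f : LInfty A) : mk (c • f) = c • mk f := rfl

noncomputable instance : NonUnitalNormedRing (AInfty A) where
  __ := (inferInstance : NormedAddCommGroup (AInfty A))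
  __ := (inferInstance : Mul (AInfty A))
  left_distrib x y z := by
    obtain ⟨f, rfl⟩ := mk_surjective x
    obtain ⟨g, rfl⟩ := mk_surjective y
    obtain ⟨h, rfl⟩ := mk_surjective z
    exact congrArg mk (mul_add f g h)
  right_distrib x y z := by
    obtain ⟨f, rfl⟩ := mk_surjective x
    obtain ⟨g, rfl⟩ := mk_surjective y
    obtain ⟨h, rfl⟩ := mk_surjective z
    exact congrArg mk (add_mul f g h)
  zero_mul x := by
    obtain ⟨f, rfl⟩ := mk_surjective x
    exact congrArg mk (zero_mul f)
  mul_zero x := by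
    obtain ⟨f, rfl⟩ := mk_surjective x
    exact congrArg mk (mul_zero f)
  mul_assoc x y z := by
    obtain ⟨f, rfl⟩ := mk_surjective x
    obtain ⟨g, rfl⟩ := mk_surjective y
    obtain ⟨h, rfl⟩ := mk_surjective z
    exact congrArg mk (mul_assoc f g h)
  norm_mul_le x y := by
    refine le_of_forall_pos_le_add fun ε hε => ?_
    have hcont : Tendsto (fun δ : ℝ => (‖x‖ + δ) * (‖y‖ + δ)) (𝓝[>] 0) (𝓝 (‖x‖ * ‖y‖)) := by
      have h : Continuous fun δ : ℝ => (‖x‖ + δ) * (‖y‖ + δ) := by fun_prop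
      simpa using (h.tendsto 0).mono_left nhdsWithin_le_nhds
    obtain ⟨δ, hδ, hδ0⟩ := ((hcont.eventually_lt_const
      (show ‖x‖ * ‖y‖ < ‖x‖ * ‖y‖ + ε by linarith)).and self_mem_nhdsWithin).exists
    obtain ⟨f, rfl, hf⟩ := exists_norm_lt x (ε := δ) hδ0
    obtain ⟨g, rfl, hg⟩ := exists_norm_lt y (ε := δ) hδ0
    calc ‖mk (f * g)‖ ≤ ‖f * g‖ := norm_mk_le _
      _ ≤ ‖f‖ * ‖g‖ := norm_mul_le _ _
      _ ≤ _ := (mul_le_mul hf.le hg.le (norm_nonneg _)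
          ((norm_nonneg _).trans hf.le)).trans hδ.le

noncomputable instance : StarRing (AInfty A) where
  star_involutive x := by
    obtain ⟨f, rfl⟩ := mk_surjective x
    exact congrArg mk (star_star f)
  star_mul x y := by
    obtain ⟨f, rfl⟩ := mk_surjective x
    obtain ⟨g, rfl⟩ := mk_surjective y
    exact congrArg mk (star_mul f g)
  star_add x y := by
    obtain ⟨f, rfl⟩ := mk_surjective x
    obtain ⟨g, rfl⟩ := mk_surjective y
    exact congrArg mk (star_add f g)

instance : CStarRing (AInfty A) where
  norm_mul_self_le x := by
    obtain ⟨f, rfl⟩ := mk_surjective x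
    set r : ℝ := ‖star (mk f) * mk f‖ with hr
    have hr0 : 0 ≤ r := norm_nonneg _
    have h1 : ‖mk (star f * f)‖ ≤ r := le_of_eq rfl
    rw [norm_mk_le_iff hr0] at h1
    have h2 : ‖mk f‖ ≤ √r := by
      rw [norm_mk_le_iff (Real.sqrt_nonneg r)]
      intro ε hε
      filter_upwards [h1 (ε ^ 2) (by positivity)] with n hn
      have h3 : ‖(star f * f) n‖ = ‖f n‖ * ‖f n‖ := by
        rw [lp.infty_coeFn_mul]
        exact CStarRing.norm_star_mul_self
      rw [h3] at hn
      have h4 := Real.sq_sqrt hr0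
      have h5 := Real.sqrt_nonneg r
      refine abs_le_of_sq_le_sq' ?_ (by positivity) |>.2
      nlinarith
    calc ‖mk f‖ * ‖mk f‖ ≤ √r * √r := mul_self_le_mul_self (norm_nonneg _) h2
      _ = r := Real.mul_self_sqrt hr0

instance : IsScalarTower ℂ (AInfty A) (AInfty A) where
  smul_assoc c x y := by
    obtain ⟨f, rfl⟩ := mk_surjective x
    obtain ⟨g, rfl⟩ := mk_surjective y
    exact congrArg mk (smul_mul_assoc c f g)

instance : SMulCommClass ℂ (AInfty A) (AInfty A) where
  smul_comm c x y := by
    obtain ⟨f, rfl⟩ := mk_surjective x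
    obtain ⟨g, rfl⟩ := mk_surjective y
    exact congrArg mk (mul_smul_comm c f g).symm

instance : StarModule ℂ (AInfty A) where
  star_smul c x := by
    obtain ⟨f, rfl⟩ := mk_surjective x
    exact congrArg mk (star_smul c f)

noncomputable instance : NonUnitalCStarAlgebra (AInfty A) where

/-! ### The shift automorphism of `A∞` -/

/-- The backward shift `(a₁, a₂, …) ↦ (a₂, a₃, …)` on `ℓ∞(A)`. -/
noncomputable def backward (f : LInfty A) : LInfty A :=
  ⟨fun n => f (n + 1), memℓp_infty ⟨‖f‖, by
    rintro _ ⟨n, rfl⟩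
    exact norm_apply_le f (n + 1)⟩⟩

/-- The forward shift `(a₁, a₂, …) ↦ (0, a₁, a₂, …)` on `ℓ∞(A)`. -/
noncomputable def forward (f : LInfty A) : LInfty A :=
  ⟨fun n => match n with
    | 0 => 0
    | n + 1 => f n, memℓp_infty ⟨‖f‖, by
    rintro _ ⟨n, rfl⟩
    cases n with
    | zero => simp
    | succ n => exact norm_apply_le f n⟩⟩

theorem backward_apply (f : LInfty A) (n : ℕ) : backward f n = f (n + 1) := rfl
theorem forward_zero (f : LInfty A) : forward f 0 = 0 := rfl
theorem forward_succ (f : LInfty A) (n : ℕ) : forward f (n + 1) = f n := rfl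

theorem backward_sub (f g : LInfty A) : backward (f - g) = backward f - backward g := rfl

theorem forward_sub (f g : LInfty A) : forward (f - g) = forward f - forward g := by
  ext n
  cases n with
  | zero => simp [forward_zero]
  | succ n => simp [forward_succ]

theorem backward_mem {f : LInfty A} (hf : f ∈ cZero A) : backward f ∈ cZero A :=
  (tendsto_add_atTop_iff_nat 1).mpr (mem_cZero.mp hf)

theorem forward_mem {f : LInfty A} (hf : f ∈ cZero A) : forward f ∈ cZero A :=
  (tendsto_add_atTop_iff_nat 1).mp (mem_cZero.mp hf)

variable (A)

/-- The automorphism `(a₁, a₂, …) + c₀(A) ↦ (a₂, a₃, …) + c₀(A)` of `A∞`, induced by the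
backward shift; its inverse is induced by the forward shift. -/
noncomputable def shift : AInfty A ≃⋆ₐ[ℂ] AInfty A where
  toFun := Quotient.map (sa := (cZero A).quotientRel) (sb := (cZero A).quotientRel)
    backward (by
    intro f g h
    refine (Submodule.quotientRel_def _).mpr ?_
    rw [← backward_sub]
    exact backward_mem ((Submodule.quotientRel_def _).mp h))
  invFun := Quotient.map (sa := (cZero A).quotientRel) (sb := (cZero A).quotientRel)
    forward (by
    intro f g h
    refine (Submodule.quotientRel_def _).mpr ?_
    rw [← forward_sub]
    exact forward_mem ((Submodule.quotientRel_def _).mp h))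
  left_inv x := by
    obtain ⟨f, rfl⟩ := mk_surjective x
    refine mk_eq_of_eventuallyEq (f := forward (backward f)) ?_
    filter_upwards [eventually_ge_atTop 1] with n hn
    obtain ⟨m, rfl⟩ := Nat.exists_eq_add_of_le' hn
    rfl
  right_inv x := by
    obtain ⟨f, rfl⟩ := mk_surjective x
    exact mk_eq_of_eventuallyEq (f := backward (forward f)) (Eventually.of_forall fun n => rfl)
  map_mul' x y := by
    obtain ⟨f, rfl⟩ := mk_surjective x
    obtain ⟨g, rfl⟩ := mk_surjective y
    rfl
  map_add' x y := by
    obtain ⟨f, rfl⟩ := mk_surjective x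
    obtain ⟨g, rfl⟩ := mk_surjective y
    rfl
  map_star' x := by
    obtain ⟨f, rfl⟩ := mk_surjective x
    rfl
  map_smul' c x := by
    obtain ⟨f, rfl⟩ := mk_surjective x
    rfl

variable {A}

theorem shift_mk (f : LInfty A) : shift A (mk f) = mk (backward f) := rfl
theorem shift_symm_mk (f : LInfty A) : (shift A).symm (mk f) = mk (forward f) := rfl

end Quotient

/-! ### The inductive limit `A_e` and its automorphism -/

section Limit

universe u

variable {A : Type u} [NonUnitalCStarAlgebra A] (φ : A →⋆ₙₐ[ℂ] A)

theorem norm_iterate_le (k : ℕ) (a : A) : ‖φ^[k] a‖ ≤ ‖a‖ := by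
  induction k with
  | zero => simp
  | succ k ih =>
    rw [Function.iterate_succ_apply']
    exact (NonUnitalStarAlgHom.norm_apply_le φ _).trans ih

theorem iterate_smul (c : ℂ) (k : ℕ) (a : A) : φ^[k] (c • a) = c • φ^[k] a := by
  induction k with
  | zero => rfl
  | succ k ih => rw [Function.iterate_succ_apply', ih, map_smul, Function.iterate_succ_apply']

theorem iterate_star (k : ℕ) (a : A) : φ^[k] (star a) = star (φ^[k] a) := by
  induction k with
  | zero => rfl
  | succ k ih => rw [Function.iterate_succ_apply', ih, map_star, Function.iterate_succ_apply']

/-- The bounded sequence `(0, …, 0, a, φ(a), φ²(a), …)` with `n` leading zeros. -/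
noncomputable def orbitSeq (n : ℕ) (a : A) : LInfty A :=
  ⟨fun m => if m < n then 0 else φ^[m - n] a, memℓp_infty ⟨‖a‖, by
    rintro _ ⟨m, rfl⟩
    dsimp only
    split_ifs
    · simp
    · exact norm_iterate_le φ _ a⟩⟩

theorem orbitSeq_apply (n m : ℕ) (a : A) :
    orbitSeq φ n a m = if m < n then 0 else φ^[m - n] a := rfl

/-- The canonical *-homomorphism from the `n`-th copy of `A` (copies being numbered
`0, 1, 2, …`) into the limit of `A → A → A → ⋯`, realized in `A∞` by
`a ↦ (0, …, 0, a, φ(a), φ²(a), …) + c₀(A)` with `n` leading zeros. -/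
noncomputable def limitMap (n : ℕ) : A →⋆ₙₐ[ℂ] AInfty A where
  toFun a := mk (orbitSeq φ n a)
  map_smul' c a := by
    refine mk_eq_of_eventuallyEq (g := c • orbitSeq φ n a) (Eventually.of_forall fun m => ?_)
    have h : orbitSeq φ n (c • a) m = c • orbitSeq φ n a m := by
      simp only [orbitSeq_apply]
      split_ifs
      · simp
      · exact iterate_smul φ c _ a
    simpa using h
  map_zero' := by
    refine mk_eq_of_eventuallyEq (g := 0) (Eventually.of_forall fun m => ?_)
    simp [orbitSeq_apply, iterate_map_zero]
  map_add' a b := by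
    refine mk_eq_of_eventuallyEq (g := orbitSeq φ n a + orbitSeq φ n b)
      (Eventually.of_forall fun m => ?_)
    rw [lp.coeFn_add, Pi.add_apply]
    simp only [orbitSeq_apply]
    split_ifs
    · simp
    · exact iterate_map_add φ _ a b
  map_mul' a b := by
    refine mk_eq_of_eventuallyEq (g := orbitSeq φ n a * orbitSeq φ n b)
      (Eventually.of_forall fun m => ?_)
    rw [lp.infty_coeFn_mul, Pi.mul_apply]
    simp only [orbitSeq_apply]
    split_ifs
    · simp
    · exact iterate_map_mul φ _ a b
  map_star' a := by
    refine mk_eq_of_eventuallyEq (g := star (orbitSeq φ n a))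
      (Eventually.of_forall fun m => ?_)
    rw [lp.coeFn_star, Pi.star_apply]
    simp only [orbitSeq_apply]
    split_ifs
    · simp
    · exact iterate_star φ _ a

theorem limitMap_apply (n : ℕ) (a : A) : limitMap φ n a = mk (orbitSeq φ n a) := rfl

/-- Compatibility with the connecting maps. -/
theorem limitMap_succ_map (n : ℕ) (a : A) : limitMap φ (n + 1) (φ a) = limitMap φ n a := by
  refine mk_eq_of_eventuallyEq ?_
  filter_upwards [eventually_ge_atTop (n + 1)] with m hm
  obtain ⟨k, rfl⟩ := Nat.exists_eq_add_of_le hm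
  rw [orbitSeq_apply, orbitSeq_apply, if_neg (by omega), if_neg (by omega),
    ← Function.iterate_succ_apply]
  congr 2
  omega

theorem shift_limitMap_succ (n : ℕ) (a : A) :
    shift A (limitMap φ (n + 1) a) = limitMap φ n a := by
  rw [limitMap_apply, limitMap_apply, shift_mk]
  refine mk_eq_of_eventuallyEq (Eventually.of_forall fun m => ?_)
  rw [backward_apply, orbitSeq_apply, orbitSeq_apply]
  simp

theorem limitMap_range_mono : Monotone fun n => NonUnitalStarAlgHom.range (limitMap φ n) := by
  refine monotone_nat_of_le_succ fun n => ?_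
  rintro _ ⟨a, rfl⟩
  exact ⟨φ a, limitMap_succ_map φ n a⟩

/-- The inductive limit `A_e` of `A → A → A → ⋯` (all connecting maps equal to `φ`): the
closure in `A∞ = ℓ∞(A) / c₀(A)` of the increasing union of the images of the canonical maps
`limitMap φ n`. -/
noncomputable def inductiveLimit : NonUnitalStarSubalgebra ℂ (AInfty A) :=
  (⨆ n, NonUnitalStarAlgHom.range (limitMap φ n)).topologicalClosure

theorem coe_inductiveLimit :
    (inductiveLimit φ : Set (AInfty A)) = closure (⋃ n, Set.range (limitMap φ n)) := by
  change closure _ = _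
  congr 1
  rw [NonUnitalStarSubalgebra.coe_iSup_of_directed (limitMap_range_mono φ).directed_le]
  rfl

instance isClosed_inductiveLimit : IsClosed (inductiveLimit φ : Set (AInfty A)) :=
  NonUnitalStarSubalgebra.isClosed_topologicalClosure _

noncomputable instance : PartialOrder (inductiveLimit φ) := CStarAlgebra.spectralOrder _

instance : StarOrderedRing (inductiveLimit φ) := CStarAlgebra.spectralOrderedRing _

theorem shift_mem {x : AInfty A} (hx : x ∈ inductiveLimit φ) :
    shift A x ∈ inductiveLimit φ := by
  rw [← SetLike.mem_coe, coe_inductiveLimit] at *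
  refine map_mem_closure (StarAlgEquiv.isometry (shift A)).continuous hx ?_
  intro y hy
  obtain ⟨n, a, rfl⟩ := Set.mem_iUnion.mp hy
  refine Set.mem_iUnion.mpr ⟨n, φ a, ?_⟩
  rw [← limitMap_succ_map φ n a, shift_limitMap_succ]

theorem shift_symm_mem {x : AInfty A} (hx : x ∈ inductiveLimit φ) :
    (shift A).symm x ∈ inductiveLimit φ := by
  rw [← SetLike.mem_coe, coe_inductiveLimit] at *
  refine map_mem_closure (StarAlgEquiv.isometry (shift A).symm).continuous hx ?_
  intro y hy
  obtain ⟨n, a, rfl⟩ := Set.mem_iUnion.mp hy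
  refine Set.mem_iUnion.mpr ⟨n + 1, a, ?_⟩
  rw [← shift_limitMap_succ φ n a, StarAlgEquiv.symm_apply_apply]

/-- The automorphism `σ` of `A_e`: the restriction of the backward shift of `A∞`. -/
noncomputable def limitAut : inductiveLimit φ ≃⋆ₐ[ℂ] inductiveLimit φ where
  toFun x := ⟨shift A x, shift_mem φ x.2⟩
  invFun x := ⟨(shift A).symm x, shift_symm_mem φ x.2⟩
  left_inv x := Subtype.ext ((shift A).symm_apply_apply x)
  right_inv x := Subtype.ext ((shift A).apply_symm_apply x)
  map_mul' x y := Subtype.ext (map_mul (shift A) (x : AInfty A) y)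
  map_add' x y := Subtype.ext (map_add (shift A) (x : AInfty A) y)
  map_star' x := Subtype.ext (map_star (shift A) (x : AInfty A))
  map_smul' c x := Subtype.ext (map_smul (shift A) c (x : AInfty A))

/-- The action `k ↦ σ ^ k` of the group of integers (written multiplicatively) on `A_e`. -/
noncomputable def limitAction :
    Multiplicative ℤ →* (inductiveLimit φ ≃⋆ₐ[ℂ] inductiveLimit φ) :=
  zpowersHom _ (limitAut φ)

end Limit

/-! ### `G`-separating actions and C*-local subalgebras -/

/-- An action `σ` of a discrete group `G` on a C*-algebra `A` is `G`-separating if for all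
positive `a₁, a₂`, all `c` and all `ε > 0` there are `d₁, d₂ ∈ A` and `g₁, g₂ ∈ G` with
`‖d_j* a_j d_j - σ_{g_j}(a_j)‖ < ε` for `j = 1, 2` and `‖d₁* c d₂‖ < ε`. -/
def IsGSeparating {G A : Type*} [Group G] [NonUnitalCStarAlgebra A] [PartialOrder A]
    [StarOrderedRing A] (σ : G →* (A ≃⋆ₐ[ℂ] A)) : Prop :=
  ∀ a₁ a₂ c : A, 0 ≤ a₁ → 0 ≤ a₂ → ∀ ε : ℝ, 0 < ε →
    ∃ (d₁ d₂ : A) (g₁ g₂ : G),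
      ‖star d₁ * a₁ * d₁ - σ g₁ a₁‖ < ε ∧
      ‖star d₂ * a₂ * d₂ - σ g₂ a₂‖ < ε ∧
      ‖star d₁ * c * d₂‖ < ε

/-- The functions of class `C_c(0,∞]₊`: the continuous functions `[0,∞) → [0,∞)` that vanish
on `[0,η]` for some `η > 0` and have a (finite) limit at infinity. The values of `ψ` on negative
numbers play no role. -/
structure IsCcPos (ψ : ℝ → ℝ) : Prop where
  continuousOn : ContinuousOn ψ (Set.Ici 0)
  nonneg : ∀ t, 0 ≤ t → 0 ≤ ψ t
  eq_zero : ∃ η, 0 < η ∧ ∀ t ∈ Set.Icc 0 η, ψ t = 0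
  tendsto : ∃ L : ℝ, Tendsto ψ atTop (𝓝 L)

/-- A *-subalgebra `B` of `A` is C*-local if `ψ(b* b) ∈ B` for all `b ∈ B` and all `ψ` in
`C_c(0,∞]₊`, where `ψ(b* b)` is given by the continuous functional calculus in `A`. -/
def IsCStarLocal {A : Type*} [NonUnitalCStarAlgebra A] (B : NonUnitalStarSubalgebra ℂ A) :
    Prop :=
  ∀ ψ : ℝ → ℝ, IsCcPos ψ → ∀ b ∈ B, cfcₙ ψ (star b * b) ∈ B

end EndomorphismLimit

/-! Elements of $A_e$ are approximated from a single copy of $A$, where $\sigma$ acts as $\varphi$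
and multiplying by an element of the copy $k$ steps later puts $\varphi^k$ on the middle factor. So
(i) is (ii) read off in $A$, up to two difficulties.

From (i) to (ii): if $b^*b$ approximates $a$ with error $\gamma$, the compression by $e$ costs
$\|e\|^2\gamma$, and (i) gives no bound on $e$, which is found only after $b$. C*-locality repairs
this (`IsCStarLocal.exists_cutdown`): some $q\in\mathcal B$, a function of $b^*b$, satisfies
$(bq)^*(bq)=(b^*b-\eta)_+$ and $q=r\,bq$ with $\|r\|^2\le 1/\eta$. Apply (i) to $bq$ and
$q_1^*cq_2$, and compress by $qe$ instead of $e$. Since $\|bqe\|^2=\|e^*(bq)^*(bq)e\|$ is close to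
the norm of a translate of $(bq)^*(bq)$, $\|qe\|^2$ is at most a constant over $\eta$
(`norm_mul_sq_le`). This bound depends only on $\eta$ and the $a_j$, so $\gamma$ can be chosen after
it and before $b$.

From (ii) to (i): since $\varphi$ need not be injective, the canonical maps need not be isometric.
The norm in $A_e$ is however the limit superior of $\|\varphi^p(\cdot)\|$, so estimates in $A_e$
hold in $A$ after applying a high power of $\varphi$ (`eventually_norm_iterate_lt`). This direction
uses neither density nor locality. -/

namespace EndomorphismLimit

/-! ### Norm estimates for compressions by $qe$ -/

section Compression

variable {C : Type*} [NonUnitalCStarAlgebra C]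

theorem norm_star_mul_mul_le (x y z : C) : ‖star x * y * z‖ ≤ ‖x‖ * ‖y‖ * ‖z‖ := by
  refine (norm_mul_le _ _).trans (mul_le_mul_of_nonneg_right ?_ (norm_nonneg _))
  simpa using norm_mul_le (star x) y

/-- If `e` compresses `F = (b q)* (b q)` to approximately `τ F`, where `F` is close to `a` and
`q` is divisible by `b q` with a quotient `r` of controlled norm, then `q e` has controlled norm. -/
theorem norm_mul_sq_le {a b q r e : C} {τ : C ≃⋆ₐ[ℂ] C} {γ η δ : ℝ} (hη : 0 < η)
    (hab : ‖star b * b - a‖ ≤ γ)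
    (hq : ‖star (b * q) * (b * q) - star b * b‖ ≤ η)
    (hr : r * (b * q) = q) (hrn : η * ‖r‖ ^ 2 ≤ 1)
    (he : ‖star e * (star (b * q) * (b * q)) * e - τ (star (b * q) * (b * q))‖ ≤ δ) :
    η * ‖q * e‖ ^ 2 ≤ ‖a‖ + γ + η + δ := by
  set F := star (b * q) * (b * q) with hF
  have h1 : ‖F‖ ≤ ‖a‖ + γ + η := by
    have : F = (F - star b * b) + (star b * b - a) + a := by abel
    calc ‖F‖ = ‖(F - star b * b) + (star b * b - a) + a‖ := by rw [← this]
      _ ≤ ‖F - star b * b‖ + ‖star b * b - a‖ + ‖a‖ := norm_add₃_le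
      _ ≤ _ := by linarith
  have h2 : ‖star e * F * e‖ ≤ ‖a‖ + γ + η + δ := by
    have h3 : ‖τ F‖ = ‖F‖ := NonUnitalStarAlgHom.norm_map τ τ.injective F
    have h4 := norm_add_le (star e * F * e - τ F) (τ F)
    rw [sub_add_cancel] at h4
    linarith
  have h5 : ‖b * q * e‖ ^ 2 = ‖star e * F * e‖ := by
    rw [sq, ← CStarRing.norm_star_mul_self, hF]
    simp only [star_mul, mul_assoc]
  have h6 : ‖q * e‖ ≤ ‖r‖ * ‖b * q * e‖ := by
    conv_lhs => rw [← hr, mul_assoc]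
    exact norm_mul_le _ _
  calc η * ‖q * e‖ ^ 2 ≤ η * (‖r‖ * ‖b * q * e‖) ^ 2 := by gcongr
    _ = (η * ‖r‖ ^ 2) * ‖b * q * e‖ ^ 2 := by ring
    _ ≤ 1 * ‖b * q * e‖ ^ 2 := by gcongr
    _ ≤ _ := by rw [one_mul, h5]; exact h2

/-- Because $e^*(bq)^*(bq)e=(qe)^*b^*b(qe)$, only the replacement of $b^*b$ by $a$ inside the
compression is amplified by $\|qe\|^2$; the other errors enter through the isometric $\tau$ or are
$\delta$ itself. -/
theorem norm_compression_sub_le {a b q e : C} {τ : C ≃⋆ₐ[ℂ] C} {γ η δ : ℝ}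
    (hab : ‖star b * b - a‖ ≤ γ)
    (hq : ‖star (b * q) * (b * q) - star b * b‖ ≤ η)
    (he : ‖star e * (star (b * q) * (b * q)) * e - τ (star (b * q) * (b * q))‖ ≤ δ) :
    ‖star (q * e) * a * (q * e) - τ a‖ ≤ ‖q * e‖ ^ 2 * γ + δ + η + γ := by
  set F := star (b * q) * (b * q) with hF
  have hτ (x : C) : ‖τ x‖ = ‖x‖ := NonUnitalStarAlgHom.norm_map τ τ.injective x
  have hFe : star e * F * e = star (q * e) * (star b * b) * (q * e) := by
    rw [hF]; simp only [star_mul, mul_assoc]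
  have h1 : star (q * e) * a * (q * e) - τ a = -(star (q * e) * (star b * b - a) * (q * e))
      + (star e * F * e - τ F) + (τ (F - star b * b) + τ (star b * b - a)) := by
    rw [hFe, mul_sub, sub_mul, map_sub, map_sub]; abel
  rw [h1]
  refine norm_add₃_le.trans ?_
  have h2 := norm_add_le (τ (F - star b * b)) (τ (star b * b - a))
  rw [hτ, hτ] at h2
  have h3 := norm_star_mul_mul_le (q * e) (star b * b - a) (q * e)
  have h4 : ‖q * e‖ * ‖star b * b - a‖ * ‖q * e‖ ≤ ‖q * e‖ ^ 2 * γ := by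
    rw [mul_right_comm, ← sq]; gcongr
  rw [norm_neg]
  linarith

end Compression

/-! ### Cutting down inside a C*-local subalgebra -/

section Cutdown

/-- The function `t ↦ √((t - η)₊ / t)` on `[0, ∞)`. -/
noncomputable def cutoff (η t : ℝ) : ℝ := √(max (t - η) 0 / max t η)

theorem continuous_cutoff {η : ℝ} (hη : 0 < η) : Continuous (cutoff η) := by
  unfold cutoff
  refine (Continuous.div (by fun_prop) (by fun_prop) fun t => ?_).sqrt
  exact (hη.trans_le (le_max_right t η)).ne'

theorem cutoff_of_le {η t : ℝ} (h : t ≤ η) : cutoff η t = 0 := by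
  simp [cutoff, h]

theorem cutoff_sq_of_le {η t : ℝ} (hη : 0 < η) (h : η ≤ t) : cutoff η t ^ 2 = (t - η) / t := by
  rw [cutoff, max_eq_left h, max_eq_left (sub_nonneg.mpr h), Real.sq_sqrt]
  exact div_nonneg (sub_nonneg.mpr h) (hη.le.trans h)

theorem isCcPos_cutoff {η : ℝ} (hη : 0 < η) : IsCcPos (cutoff η) where
  continuousOn := (continuous_cutoff hη).continuousOn
  nonneg _ _ := Real.sqrt_nonneg _
  eq_zero := ⟨η, hη, fun _ ht => cutoff_of_le ht.2⟩
  tendsto := by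
    refine ⟨√(1 - 0), ?_⟩
    have h : Tendsto (fun t : ℝ => √(1 - η / t)) atTop (𝓝 √(1 - 0)) :=
      (Real.continuous_sqrt.tendsto _).comp
        (tendsto_const_nhds.sub (tendsto_const_nhds.div_atTop tendsto_id))
    refine h.congr' ?_
    filter_upwards [eventually_ge_atTop η] with t ht
    rw [cutoff, max_eq_left ht, max_eq_left (sub_nonneg.mpr ht), sub_div,
      div_self (hη.trans_le ht).ne']

variable {A : Type*} [NonUnitalCStarAlgebra A]

theorem quasispectrum_star_mul_self_nonneg (b : A) {t : ℝ}
    (ht : t ∈ quasispectrum ℝ (star b * b)) : 0 ≤ t := by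
  let _ : PartialOrder A := CStarAlgebra.spectralOrder A
  have _ : StarOrderedRing A := CStarAlgebra.spectralOrderedRing A
  exact quasispectrum_nonneg_of_nonneg _ (star_mul_self_nonneg b) t ht

/-- In a C*-local subalgebra `B`, each `b* b` is within `η` of `(b q)* (b q)` for some `q` in `B`
with `q = r b q` and `‖r‖ ≤ η ^ (-1/2)`. -/
theorem IsCStarLocal.exists_cutdown {B : NonUnitalStarSubalgebra ℂ A} (hB : IsCStarLocal B)
    {b : A} (hb : b ∈ B) {η : ℝ} (hη : 0 < η) :
    ∃ q ∈ B, ∃ r : A, ‖star (b * q) * (b * q) - star b * b‖ ≤ η ∧ r * (b * q) = q ∧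
      η * ‖r‖ ^ 2 ≤ 1 := by
  set x := star b * b with hx
  have hxs : IsSelfAdjoint x := IsSelfAdjoint.star_mul_self b
  -- A continuous substitute for $1/t$: it equals $1/t$ where $t\ge\eta$, which is where `cutoff η`
  -- can be nonzero. Hence $r=s(x)b^*$ satisfies $r\,bq=s(x)\,x\,q=q$, while
  -- $\|r\|^2=\|s(x)\,x\,s(x)\|\le 1/\eta$.
  set s : ℝ → ℝ := fun t => t / max t η ^ 2 with hs
  have hsc : Continuous s := by
    refine continuous_id.div (by fun_prop) fun t => ?_
    exact (pow_pos (hη.trans_le (le_max_right t η)) 2).ne'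
  have hs0 : s 0 = 0 := by simp [hs]
  have hqc := continuous_cutoff hη
  have hq0 : cutoff η 0 = 0 := cutoff_of_le hη.le
  have hqs : star (cfcₙ (cutoff η) x) = cfcₙ (cutoff η) x :=
    (cfcₙ_predicate (cutoff η) x : IsSelfAdjoint _)
  have hss : star (cfcₙ s x) = cfcₙ s x := (cfcₙ_predicate s x : IsSelfAdjoint _)
  have hprod (f : ℝ → ℝ) (hf : Continuous f) (hf0 : f 0 = 0) (g : ℝ → ℝ) (hg : Continuous g)
      (hg0 : g 0 = 0) : cfcₙ f x * (x * cfcₙ g x) = cfcₙ (fun t => f t * (t * g t)) x := by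
    rw [cfcₙ_mul f (fun t => t * g t) x hf.continuousOn hf0 (by fun_prop) (by simp),
      cfcₙ_mul (fun t => t) g x (by fun_prop) rfl hg.continuousOn hg0, cfcₙ_id' ℝ x]
  refine ⟨cfcₙ (cutoff η) x, hB _ (isCcPos_cutoff hη) b hb, cfcₙ s x * star b, ?_, ?_, ?_⟩
  · have h1 : star (b * cfcₙ (cutoff η) x) * (b * cfcₙ (cutoff η) x) - x
        = cfcₙ (fun t => cutoff η t * (t * cutoff η t) - t) x := by
      rw [cfcₙ_sub (fun t => cutoff η t * (t * cutoff η t)) (fun t => t) x (by fun_prop)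
        (by simp) (by fun_prop) rfl, cfcₙ_id' ℝ x, ← hprod _ hqc hq0 _ hqc hq0, star_mul, hqs, hx]
      simp only [mul_assoc]
    rw [h1]
    refine norm_cfcₙ_le fun t ht => ?_
    have ht0 := quasispectrum_star_mul_self_nonneg b ht
    rcases le_total t η with h | h
    · simpa [cutoff_of_le h, abs_of_nonneg ht0] using h
    · have h2 : cutoff η t * (t * cutoff η t) - t = -η := by
        have h3 : cutoff η t * (t * cutoff η t) = t * cutoff η t ^ 2 := by ring
        rw [h3, cutoff_sq_of_le hη h, mul_div_cancel₀ _ (hη.trans_le h).ne']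
        ring
      rw [h2, norm_neg, Real.norm_of_nonneg hη.le]
  · rw [mul_assoc, ← mul_assoc (star b), ← hx, hprod _ hsc hs0 _ hqc hq0]
    refine cfcₙ_congr fun t _ => ?_
    rcases le_total t η with h | h
    · simp [cutoff_of_le h]
    · have := (hη.trans_le h).ne'
      simp only [hs, max_eq_left h]
      field_simp
  · have h1 : ‖cfcₙ s x * star b‖ ^ 2 = ‖cfcₙ (fun t => s t * (t * s t)) x‖ := by
      rw [sq, ← CStarRing.norm_self_mul_star, ← hprod _ hsc hs0 _ hsc hs0, star_mul, hss,
        star_star, hx]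
      simp only [mul_assoc]
    have h2 : ‖cfcₙ (fun t => s t * (t * s t)) x‖ ≤ 1 / η := by
      refine norm_cfcₙ_le fun t ht => ?_
      have ht0 := quasispectrum_star_mul_self_nonneg b ht
      have hm : 0 < max t η := hη.trans_le (le_max_right t η)
      have h3 : s t * (t * s t) = (t / max t η) ^ 3 * (1 / max t η) := by
        simp only [hs]; field_simp
      rw [h3, Real.norm_of_nonneg (by positivity)]
      have h4 : (t / max t η) ^ 3 ≤ 1 :=
        pow_le_one₀ (by positivity) ((div_le_one hm).mpr (le_max_left t η))
      calc _ ≤ 1 * (1 / max t η) := by gcongr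
        _ ≤ 1 / η := by rw [one_mul]; gcongr; exact le_max_right t η
    rw [h1]
    calc _ ≤ η * (1 / η) := by gcongr
      _ = 1 := by field_simp

end Cutdown

/-! ### Computing in the limit through the copies of $A$ -/

section Limit

variable {A : Type*} [NonUnitalCStarAlgebra A] (φ : A →⋆ₙₐ[ℂ] A)

/-- The canonical map from the `n`-th copy of `A` into `A_e`. -/
noncomputable def toLimit (n : ℕ) : A →⋆ₙₐ[ℂ] inductiveLimit φ :=
  NonUnitalStarAlgHom.codRestrict (limitMap φ n) (inductiveLimit φ) fun a => by
    rw [← SetLike.mem_coe, coe_inductiveLimit]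
    exact subset_closure (Set.mem_iUnion.mpr ⟨n, a, rfl⟩)

theorem toLimit_add_iterate (n k : ℕ) (a : A) : toLimit φ (n + k) (φ^[k] a) = toLimit φ n a := by
  induction k with
  | zero => rfl
  | succ k ih =>
    rw [← ih, Function.iterate_succ_apply']
    exact Subtype.ext (limitMap_succ_map φ (n + k) _)

theorem limitAut_toLimit (n : ℕ) (a : A) : limitAut φ (toLimit φ n a) = toLimit φ n (φ a) := by
  rw [← toLimit_add_iterate φ n 1 a]
  exact Subtype.ext (shift_limitMap_succ φ n _)

theorem limitAut_pow_toLimit (n k : ℕ) (a : A) :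
    (limitAut φ ^ k) (toLimit φ n a) = toLimit φ n (φ^[k] a) := by
  induction k with
  | zero => rfl
  | succ k ih =>
    rw [pow_succ', StarAlgEquiv.mul_apply, ih, limitAut_toLimit, Function.iterate_succ_apply']

/-- A negative power of $\sigma$ need not preserve a given copy of $A$. Moving $k$ copies further
applies $\varphi^k$ first, which $\sigma^{-k}$ then undoes. -/
theorem limitAction_toLimit {j : ℤ} {m k n : ℕ} (h : j + k = n) (a : A) :
    limitAction φ (Multiplicative.ofAdd j) (toLimit φ m a) = toLimit φ (m + k) (φ^[n] a) := by
  obtain rfl : j = -k + n := by omega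
  have h1 : limitAction φ (Multiplicative.ofAdd (-(k : ℤ) + n))
      = (limitAut φ ^ k)⁻¹ * limitAut φ ^ n := by
    simp [limitAction, zpow_add]
  rw [h1, StarAlgEquiv.mul_apply, limitAut_pow_toLimit, ← toLimit_add_iterate φ m k,
    ← limitAut_pow_toLimit φ (m + k) k, ← StarAlgEquiv.mul_apply, inv_mul_cancel]
  rfl

theorem eventually_norm_iterate_lt {n : ℕ} {a : A} {ε : ℝ} (h : ‖toLimit φ n a‖ < ε) :
    ∀ᶠ p in atTop, ‖φ^[p] a‖ < ε := by
  -- Half of the gap below $\varepsilon$ keeps the final inequality strict.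
  have h1 := (norm_mk_le_iff (f := orbitSeq φ n a) (norm_nonneg (toLimit φ n a))).mp le_rfl
    ((ε - ‖toLimit φ n a‖) / 2) (by linarith)
  filter_upwards [(tendsto_add_atTop_nat n).eventually h1] with p hp
  rw [orbitSeq_apply, if_neg (by omega), Nat.add_sub_cancel] at hp
  linarith

variable {φ}

/-- An approximant in one copy is carried by powers of $\varphi$, which preserve $S$, to every later
copy. Stating this for all large $m$ lets several elements be approximated in a common copy. -/
theorem exists_toLimit_norm_sub_lt {S : Set A} (hS : Dense S) (hφ : ∀ b ∈ S, φ b ∈ S)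
    (x : inductiveLimit φ) {ε : ℝ} (hε : 0 < ε) :
    ∀ᶠ m in atTop, ∃ b ∈ S, ‖toLimit φ m b - x‖ < ε := by
  have hx : (x : AInfty A) ∈ closure (⋃ n, Set.range (limitMap φ n)) := by
    rw [← coe_inductiveLimit]; exact x.2
  obtain ⟨_, hy, hxy⟩ := Metric.mem_closure_iff.mp hx (ε / 2) (half_pos hε)
  obtain ⟨n, a, rfl⟩ := Set.mem_iUnion.mp hy
  obtain ⟨b, hb, hab⟩ := Metric.mem_closure_iff.mp (hS a) (ε / 2) (half_pos hε)
  rw [dist_eq_norm] at hab hxy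
  filter_upwards [eventually_ge_atTop n] with m hm
  obtain ⟨k, rfl⟩ := Nat.exists_eq_add_of_le hm
  have hbk : φ^[k] b ∈ S := by
    clear hm
    induction k with
    | zero => exact hb
    | succ k ih => rw [Function.iterate_succ_apply']; exact hφ _ ih
  refine ⟨_, hbk, ?_⟩
  rw [toLimit_add_iterate, norm_sub_rev]
  have h1 : ‖toLimit φ n (a - b)‖ ≤ ‖a - b‖ := NonUnitalStarAlgHom.norm_apply_le _ _
  have h2 : ‖x - toLimit φ n a‖ < ε / 2 := hxy
  have h3 : x - toLimit φ n b = (x - toLimit φ n a) + toLimit φ n (a - b) := by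
    rw [map_sub]; abel
  rw [h3]
  exact (norm_add_le _ _).trans_lt (by linarith)

theorem exists_toLimit_star_mul_self_lt {S : Set A} (hS : Dense S) (hφ : ∀ b ∈ S, φ b ∈ S)
    {x : inductiveLimit φ} (hx : 0 ≤ x) {ε : ℝ} (hε : 0 < ε) :
    ∀ᶠ m in atTop, ∃ b ∈ S, ‖star (toLimit φ m b) * toLimit φ m b - x‖ < ε := by
  obtain ⟨y, rfl⟩ := CStarAlgebra.nonneg_iff_eq_star_mul_self.mp hx
  have hc : Continuous fun z : inductiveLimit φ => star z * z := by fun_prop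
  obtain ⟨δ, hδ, h⟩ := Metric.continuous_iff.mp hc y ε hε
  filter_upwards [exists_toLimit_norm_sub_lt hS hφ y hδ] with m ⟨b, hb, hby⟩
  refine ⟨b, hb, ?_⟩
  simpa only [dist_eq_norm] using h _ (by rwa [dist_eq_norm])

end Limit

/-! ### The two implications -/

section Main

variable {A : Type*} [NonUnitalCStarAlgebra A] {φ : A →⋆ₙₐ[ℂ] A}

theorem norm_toLimit_compression_lt {m k l : ℕ} {x y e f : A} {ε : ℝ} (τ : inductiveLimit φ)
    (hτ : τ = toLimit φ (m + k) (φ^[l] y))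
    (h : ‖star e * φ^[k] x * f - φ^[l] y‖ < ε) :
    ‖star (toLimit φ (m + k) e) * toLimit φ m x * toLimit φ (m + k) f - τ‖ < ε := by
  rw [hτ, ← toLimit_add_iterate φ m k x, ← map_star, ← map_mul, ← map_mul, ← map_sub]
  exact (NonUnitalStarAlgHom.norm_apply_le _ _).trans_lt h

theorem isGSeparating_of_approx (B : NonUnitalStarSubalgebra ℂ A) (hBdense : Dense (B : Set A))
    (hBinv : ∀ b ∈ B, φ b ∈ B) (hBlocal : IsCStarLocal B)
    (H : ∀ b₁ ∈ B, ∀ b₂ ∈ B, ∀ c ∈ B, ∀ ε : ℝ, 0 < ε →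
      ∃ (k n₁ n₂ : ℕ) (e₁ e₂ : A),
        ‖star e₁ * φ^[k] (star b₁ * b₁) * e₁ - φ^[n₁] (star b₁ * b₁)‖ < ε ∧
        ‖star e₂ * φ^[k] (star b₂ * b₂) * e₂ - φ^[n₂] (star b₂ * b₂)‖ < ε ∧
        ‖star e₁ * φ^[k] c * e₂‖ < ε) :
    IsGSeparating (limitAction φ) := by
  intro a₁ a₂ c ha₁ ha₂ ε hε
  set η : ℝ := min (ε / 4) 1 with hηdef
  have hη : 0 < η := by positivity
  have hηε : η ≤ ε / 4 := min_le_left _ _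
  have hη1 : η ≤ 1 := min_le_right _ _
  -- The bound for $\|qe\|^2$: the $3$ covers $\gamma+\eta+\delta$ with $\delta=\eta$ and
  -- $\gamma,\eta\le 1$. It is fixed before $\gamma$, so that $K\gamma+\gamma\le\varepsilon/4$ can
  -- be imposed.
  set K : ℝ := (‖a₁‖ + ‖a₂‖ + 3) / η with hK
  have hK0 : 0 < K := by positivity
  set γ : ℝ := min (ε / (4 * (K + 1))) 1 with hγdef
  have hγ : 0 < γ := by positivity
  have hγ1 : γ ≤ 1 := min_le_right _ _
  have hKγ : K * γ + γ ≤ ε / 4 := by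
    calc K * γ + γ = (K + 1) * γ := by ring
      _ ≤ (K + 1) * (ε / (4 * (K + 1))) := by gcongr; exact min_le_left _ _
      _ = ε / 4 := by field_simp
  obtain ⟨m, ⟨b₁, hb₁, hab₁⟩, ⟨b₂, hb₂, hab₂⟩, ⟨c', hc', hcc⟩⟩ :=
    ((exists_toLimit_star_mul_self_lt hBdense hBinv ha₁ hγ).and
      ((exists_toLimit_star_mul_self_lt hBdense hBinv ha₂ hγ).and
        (exists_toLimit_norm_sub_lt hBdense hBinv c hγ))).exists
  obtain ⟨q₁, hqB₁, r₁, hq₁, hr₁, hrn₁⟩ := hBlocal.exists_cutdown hb₁ hη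
  obtain ⟨q₂, hqB₂, r₂, hq₂, hr₂, hrn₂⟩ := hBlocal.exists_cutdown hb₂ hη
  -- The factors $q_j$ are built into the middle element because the final compressors are $q_je_j$.
  obtain ⟨k, n₁, n₂, e₁, e₂, he₁, he₂, hce⟩ := H (b₁ * q₁) (mul_mem hb₁ hqB₁) (b₂ * q₂)
    (mul_mem hb₂ hqB₂) (star q₁ * c' * q₂) (mul_mem (mul_mem (star_mem hqB₁) hc') hqB₂) η hη
  have key (a : inductiveLimit φ) (ha : ‖a‖ ≤ ‖a₁‖ + ‖a₂‖) (b q r e : A) (n : ℕ)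
      (hab : ‖star (toLimit φ m b) * toLimit φ m b - a‖ < γ)
      (hq : ‖star (b * q) * (b * q) - star b * b‖ ≤ η) (hr : r * (b * q) = q)
      (hrn : η * ‖r‖ ^ 2 ≤ 1)
      (he : ‖star e * φ^[k] (star (b * q) * (b * q)) * e - φ^[n] (star (b * q) * (b * q))‖ < η) :
      ‖toLimit φ m q * toLimit φ (m + k) e‖ ^ 2 ≤ K ∧
      ‖star (toLimit φ m q * toLimit φ (m + k) e) * a * (toLimit φ m q * toLimit φ (m + k) e)
        - limitAction φ (Multiplicative.ofAdd ((n : ℤ) - k)) a‖ < ε := by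
    have hq' : ‖star (toLimit φ m b * toLimit φ m q) * (toLimit φ m b * toLimit φ m q)
        - star (toLimit φ m b) * toLimit φ m b‖ ≤ η := by
      simp only [← map_mul, ← map_star, ← map_sub]
      exact (NonUnitalStarAlgHom.norm_apply_le _ _).trans hq
    have hr' : toLimit φ m r * (toLimit φ m b * toLimit φ m q) = toLimit φ m q := by
      simp only [← map_mul, hr]
    have hrn' : η * ‖toLimit φ m r‖ ^ 2 ≤ 1 := by
      refine le_trans ?_ hrn
      gcongr
      exact NonUnitalStarAlgHom.norm_apply_le _ _
    have he' := norm_toLimit_compression_lt (m := m) _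
      (limitAction_toLimit φ (j := (n : ℤ) - k) (by omega) _) he
    rw [map_mul, map_star, map_mul] at he'
    have hnorm : ‖toLimit φ m q * toLimit φ (m + k) e‖ ^ 2 ≤ K := by
      rw [hK, le_div_iff₀' hη]
      linarith [norm_mul_sq_le hη hab.le hq' hr' hrn' he'.le]
    refine ⟨hnorm, (norm_compression_sub_le hab.le hq' he'.le).trans_lt ?_⟩
    have : ‖toLimit φ m q * toLimit φ (m + k) e‖ ^ 2 * γ ≤ K * γ := by gcongr
    linarith
  obtain ⟨hD₁, hd₁⟩ := key a₁ (by linarith [norm_nonneg a₂]) b₁ q₁ r₁ e₁ n₁ hab₁ hq₁ hr₁ hrn₁ he₁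
  obtain ⟨hD₂, hd₂⟩ := key a₂ (by linarith [norm_nonneg a₁]) b₂ q₂ r₂ e₂ n₂ hab₂ hq₂ hr₂ hrn₂ he₂
  refine ⟨_, _, _, _, hd₁, hd₂, ?_⟩
  set D₁ := toLimit φ m q₁ * toLimit φ (m + k) e₁ with hD₁def
  set D₂ := toLimit φ m q₂ * toLimit φ (m + k) e₂ with hD₂def
  have h1 : ‖star D₁ * toLimit φ m c' * D₂‖ < η := by
    -- The off-diagonal estimate is a compression with target $0$.
    have h2 := norm_toLimit_compression_lt (m := m) (l := 0) (y := 0) (φ := φ) 0 (by simp)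
      (show ‖star e₁ * φ^[k] (star q₁ * c' * q₂) * e₂ - φ^[0] 0‖ < η by simpa using hce)
    simpa only [sub_zero, map_mul, map_star, hD₁def, hD₂def, star_mul, mul_assoc] using h2
  have h2 : ‖D₁‖ * ‖c - toLimit φ m c'‖ * ‖D₂‖ ≤ K * γ := by
    have h3 : ‖D₁‖ * ‖D₂‖ ≤ K := by nlinarith [sq_nonneg (‖D₁‖ - ‖D₂‖)]
    rw [norm_sub_rev, mul_right_comm]
    gcongr
  have h3 : star D₁ * c * D₂ = star D₁ * (c - toLimit φ m c') * D₂
      + star D₁ * toLimit φ m c' * D₂ := by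
    rw [mul_sub, sub_mul, sub_add_cancel]
  rw [h3]
  have h4 := norm_star_mul_mul_le D₁ (c - toLimit φ m c') D₂
  exact (norm_add_le _ _).trans_lt (by linarith)

theorem approx_of_isGSeparating (H : IsGSeparating (limitAction φ)) (b₁ b₂ c : A) {ε : ℝ}
    (hε : 0 < ε) :
    ∃ (k n₁ n₂ : ℕ) (e₁ e₂ : A),
      ‖star e₁ * φ^[k] (star b₁ * b₁) * e₁ - φ^[n₁] (star b₁ * b₁)‖ < ε ∧
      ‖star e₂ * φ^[k] (star b₂ * b₂) * e₂ - φ^[n₂] (star b₂ * b₂)‖ < ε ∧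
      ‖star e₁ * φ^[k] c * e₂‖ < ε := by
  have hpos (b : A) : 0 ≤ toLimit φ 0 (star b * b) := by
    rw [map_mul, map_star]; exact star_mul_self_nonneg _
  obtain ⟨d₁, d₂, g₁, g₂, h₁, h₂, h₃⟩ := H _ _ (toLimit φ 0 c) (hpos b₁) (hpos b₂) ε hε
  -- The three quantities depend continuously on $(d_1,d_2)$, so the strict inequalities survive
  -- replacing $d_1,d_2$ by nearby elements of one copy of $A$.
  set F : inductiveLimit φ × inductiveLimit φ → ℝ × ℝ × ℝ := fun d =>
    (‖star d.1 * toLimit φ 0 (star b₁ * b₁) * d.1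
        - limitAction φ g₁ (toLimit φ 0 (star b₁ * b₁))‖,
      ‖star d.2 * toLimit φ 0 (star b₂ * b₂) * d.2
        - limitAction φ g₂ (toLimit φ 0 (star b₂ * b₂))‖,
      ‖star d.1 * toLimit φ 0 c * d.2‖) with hF
  have hFc : Continuous F := by fun_prop
  have hopen : IsOpen (F ⁻¹' (Set.Iio ε ×ˢ Set.Iio ε ×ˢ Set.Iio ε)) :=
    (isOpen_Iio.prod (isOpen_Iio.prod isOpen_Iio)).preimage hFc
  obtain ⟨δ, hδ, hball⟩ := Metric.isOpen_iff.mp hopen (d₁, d₂) ⟨h₁, h₂, h₃⟩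
  -- The last condition on $m$ makes both exponents $g_j+m$ nonnegative, so the translates are
  -- genuine iterates of $\varphi$ in the $m$-th copy.
  obtain ⟨m, ⟨f₁, -, hf₁⟩, ⟨f₂, -, hf₂⟩, hm⟩ :=
    ((exists_toLimit_norm_sub_lt dense_univ (by simp) d₁ hδ).and
      ((exists_toLimit_norm_sub_lt dense_univ (by simp) d₂ hδ).and
        (eventually_ge_atTop (g₁.toAdd.natAbs + g₂.toAdd.natAbs)))).exists
  have hmem : (toLimit φ m f₁, toLimit φ m f₂) ∈ Metric.ball (d₁, d₂) δ := by
    rw [Metric.mem_ball, Prod.dist_eq, dist_eq_norm, dist_eq_norm]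
    exact max_lt hf₁ hf₂
  obtain ⟨hF₁, hF₂, hF₃⟩ := hball hmem
  obtain ⟨n₁, hn₁⟩ := Int.eq_ofNat_of_zero_le (a := g₁.toAdd + m) (by omega)
  obtain ⟨n₂, hn₂⟩ := Int.eq_ofNat_of_zero_le (a := g₂.toAdd + m) (by omega)
  have pull (x f g : A) : star (toLimit φ m f) * toLimit φ 0 x * toLimit φ m g
      = toLimit φ m (star f * φ^[m] x * g) := by
    rw [map_mul, map_mul, map_star, ← toLimit_add_iterate φ 0 m x, zero_add]
  have push (g : Multiplicative ℤ) (n : ℕ) (hn : g.toAdd + m = n) (x : A) :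
      limitAction φ g (toLimit φ 0 x) = toLimit φ m (φ^[n] x) := by
    have h := limitAction_toLimit φ (m := 0) hn x
    rwa [zero_add] at h
  simp only [hF, Set.mem_Iio, pull, push g₁ n₁ hn₁, push g₂ n₂ hn₂, ← map_sub] at hF₁ hF₂ hF₃
  obtain ⟨p, hp₁, hp₂, hp₃⟩ := ((eventually_norm_iterate_lt φ hF₁).and
    ((eventually_norm_iterate_lt φ hF₂).and (eventually_norm_iterate_lt φ hF₃))).exists
  -- The $p$ extra applications of $\varphi$ turn the norm bounds in $A_e$ into norm bounds in $A$;
  -- being multiplicative, $\varphi^p$ distributes over the compressions.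
  refine ⟨p + m, p + n₁, p + n₂, φ^[p] f₁, φ^[p] f₂, ?_⟩
  simp only [iterate_map_sub, iterate_map_mul, ← iterate_star, Function.iterate_add_apply]
    at hp₁ hp₂ hp₃ ⊢
  exact ⟨hp₁, hp₂, hp₃⟩

end Main

end EndomorphismLimit

theorem proposition6p10 {A : Type*} [NonUnitalCStarAlgebra A] (φ : A →⋆ₙₐ[ℂ] A)
    (B : NonUnitalStarSubalgebra ℂ A) (hBdense : Dense (B : Set A))
    (hBinv : ∀ b ∈ B, φ b ∈ B) (hBlocal : EndomorphismLimit.IsCStarLocal B) :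
    (∀ b₁ ∈ B, ∀ b₂ ∈ B, ∀ c ∈ B, ∀ ε : ℝ, 0 < ε →
      ∃ (k n₁ n₂ : ℕ) (e₁ e₂ : A),
        ‖star e₁ * φ^[k] (star b₁ * b₁) * e₁ - φ^[n₁] (star b₁ * b₁)‖ < ε ∧
        ‖star e₂ * φ^[k] (star b₂ * b₂) * e₂ - φ^[n₂] (star b₂ * b₂)‖ < ε ∧
        ‖star e₁ * φ^[k] c * e₂‖ < ε) ↔
    EndomorphismLimit.IsGSeparating (EndomorphismLimit.limitAction φ) :=
  ⟨EndomorphismLimit.isGSeparating_of_approx B hBdense hBinv hBlocal,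
    fun H b₁ _ b₂ _ c _ _ hε => EndomorphismLimit.approx_of_isGSeparating H b₁ b₂ c hε⟩
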